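/- Let a group $G$ act on a topological space $M$. A subset $U\subseteq M$ is called $G$-categorical if it is open and $G$-invariant and there is a continuous map $H:U\times[0,1]\to M$ such that $gH(x,t)=H(gx,t)$ for all $g\in G$, $x\in U$, $t\in[0,1]$, $H(x,0)=x$ for all $x\in U$, and $H(U\times\{1\})$ is contained in a single $G$-orbit. The equivariant Lusternik–Schnirelmann category $\mathrm{cat}_G(M)$ is the least number of $G$-categorical sets required to cover $M$ (and $\infty$ if $M$ has no finite cover by such sets). For every integer $n\ge 0$, let $SU(n+1)$, the group of complex unitary $(n+1)\times(n+1)$ matrices of determinant $1$ with its usual topology, act on itself by conjugation, $g\cdot x=gxg^{-1}$. Then $$\mathrm{cat}_{SU(n+1)}\,SU(n+1)=n+1.$$ -/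

import Mathlib

open scoped unitInterval

/-- A subset `U` of a space `M` with an action of `G` is `G`-categorical if it is open and
`G`-invariant and there is a `G`-equivariant homotopy `H : U × [0,1] → M` such that `H₀` is the
inclusion of `U` and `H₁` maps `U` into a single orbit. -/
def IsGCategorical (G : Type*) {M : Type*} [Group G] [TopologicalSpace M] [MulAction G M]
    (U : Set M) : Prop :=
  IsOpen U ∧
  ∃ hU : ∀ (g : G) (x : M), x ∈ U → g • x ∈ U,
  ∃ H : C(U × I, M),
    (∀ (g : G) (x : U) (t : I), g • H (x, t) = H (⟨g • (x : M), hU g x x.2⟩, t)) ∧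
    (∀ x : U, H (x, 0) = x) ∧
    (∃ y : M, ∀ x : U, H (x, 1) ∈ MulAction.orbit G y)

/-- The equivariant Lusternik-Schnirelmann category `cat_G(M)`: the least number of `G`-categorical
sets required to cover `M`, and `∞` if there is no finite cover of `M` by such sets. -/
noncomputable def equivariantCat (G M : Type*) [Group G] [TopologicalSpace M] [MulAction G M] :
    ℕ∞ :=
  sInf {k : ℕ∞ | ∃ C : Set (Set M),
    (∀ U ∈ C, IsGCategorical G U) ∧ ⋃₀ C = Set.univ ∧ C.encard = k}

/-! ### The center of the special unitary group and the lower bound. -/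

namespace Matrix

variable {ι : Type*} [Fintype ι] [DecidableEq ι]

/-! Let N be the matrix size. The fixed points of conjugation are the N central matrices z • 1 with
z ^ N = 1. An equivariant homotopy keeps a fixed point inside this finite set, so it cannot move it;
as the homotopy ends in a single orbit, a categorical set contains at most one central element
(`eq_of_central_of_isGCategorical`). Hence at least N sets are needed.

For the upper bound, take the matrices exp(iX) with X Hermitian, traceless and with spectrum in some
open interval of length 2π. On such X the exponential is injective (`eq_of_expUnitary_eq`) and has a
continuous equivariant inverse, so exp(i(1 - t)X) contracts this open set to 1
(`isGCategorical_expNarrow`). Its N translates by central elements are categorical and cover the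
group: any logarithm of A with narrow spectrum has trace in 2πℤ, and a central factor shifts the
trace to 0 (`exists_scalar_mul_mem_expNarrow`). -/

theorem smul_one_mem_specialUnitaryGroup [Nonempty ι] {z : ℂ} (hz : z ^ Fintype.card ι = 1) :
    z • (1 : Matrix ι ι ℂ) ∈ specialUnitaryGroup ι ℂ := by
  have h1 : ‖z‖ = 1 := Complex.norm_eq_one_of_pow_eq_one hz Fintype.card_ne_zero
  rw [mem_specialUnitaryGroup_iff, mem_unitaryGroup_iff]
  refine ⟨?_, by simp [hz]⟩
  rw [star_smul, star_one, smul_mul_smul_comm, one_mul, Complex.star_def, Complex.mul_conj,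
    Complex.normSq_eq_norm_sq, h1]
  simp

/-- The scalar matrix attached to a root of unity, as an element of the special unitary group. -/
def scalarSU [Nonempty ι] (z : ℂ) (hz : z ^ Fintype.card ι = 1) : specialUnitaryGroup ι ℂ :=
  ⟨z • 1, smul_one_mem_specialUnitaryGroup hz⟩

theorem scalarSU_comm [Nonempty ι] {z : ℂ} (hz : z ^ Fintype.card ι = 1)
    (g : specialUnitaryGroup ι ℂ) : scalarSU z hz * g = g * scalarSU z hz :=
  Subtype.ext (by simp [scalarSU])

/-- Every unitary matrix is a scalar multiple of a special unitary one. -/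
theorem exists_smul_mem_specialUnitaryGroup [Nonempty ι] {U : Matrix ι ι ℂ}
    (hU : U ∈ unitaryGroup ι ℂ) : ∃ c : ℂ, c ≠ 0 ∧ c • U ∈ specialUnitaryGroup ι ℂ := by
  have hd : ‖U.det‖ = 1 := by
    simpa using CStarRing.norm_of_mem_unitary (det_of_mem_unitary hU)
  have hd0 : U.det ≠ 0 := by
    intro h
    simp [h] at hd
  -- The scalar c multiplies the determinant by c ^ N, so it must be an N-th root of the inverse
  -- determinant.
  obtain ⟨c, hc⟩ := IsAlgClosed.exists_pow_nat_eq (U.det)⁻¹ (Fintype.card_pos (α := ι))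
  have hc1 : ‖c‖ = 1 := by
    have : ‖c‖ ^ Fintype.card ι = 1 := by rw [← norm_pow, hc, norm_inv, hd, inv_one]
    exact (pow_eq_one_iff_of_nonneg (norm_nonneg _) Fintype.card_ne_zero).1 this
  refine ⟨c, fun h => by simp [h] at hc1, ?_⟩
  rw [mem_specialUnitaryGroup_iff, mem_unitaryGroup_iff]
  refine ⟨?_, by rw [det_smul, hc, inv_mul_cancel₀ hd0]⟩
  rw [star_smul, smul_mul_smul_comm, mem_unitaryGroup_iff.1 hU, Complex.star_def, Complex.mul_conj,
    Complex.normSq_eq_norm_sq, hc1]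
  simp

open scoped Matrix.Norms.L2Operator in
-- Unitaries span any C⋆-algebra, and each unitary matrix is a multiple of a special unitary one.
theorem commute_of_forall_specialUnitaryGroup [Nonempty ι] {A : Matrix ι ι ℂ}
    (hA : ∀ g ∈ specialUnitaryGroup ι ℂ, Commute A g) (B : Matrix ι ι ℂ) : Commute A B := by
  have hB : B ∈ Submodule.span ℂ (unitary (Matrix ι ι ℂ) : Set (Matrix ι ι ℂ)) := by
    rw [CStarAlgebra.span_unitary]
    trivial
  induction hB using Submodule.span_induction with
  | mem U hU =>
    obtain ⟨c, hc, h⟩ := exists_smul_mem_specialUnitaryGroup hU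
    have := (hA _ h).smul_right c⁻¹
    rwa [inv_smul_smul₀ hc] at this
  | zero => exact Commute.zero_right A
  | add x y _ _ hx hy => exact hx.add_right hy
  | smul a x _ hx => exact hx.smul_right a

theorem exists_eq_smul_one_of_central [Nonempty ι] {A : specialUnitaryGroup ι ℂ}
    (hA : ∀ g, g * A = A * g) :
    ∃ z : ℂ, z ^ Fintype.card ι = 1 ∧ (A : Matrix ι ι ℂ) = z • 1 := by
  have hcomm := commute_of_forall_specialUnitaryGroup (A := (A : Matrix ι ι ℂ))
    fun g hg => (congrArg Subtype.val (hA ⟨g, hg⟩)).symm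
  obtain ⟨z, hz⟩ := mem_range_scalar_iff_commute_single'.2 fun i j => (hcomm (single i j 1)).symm
  have hz' : (A : Matrix ι ι ℂ) = z • 1 := by rw [← hz, scalar_apply, smul_one_eq_diagonal]
  refine ⟨z, ?_, hz'⟩
  have := (mem_specialUnitaryGroup_iff.1 A.2).2
  rwa [hz', det_smul, det_one, mul_one] at this

/-- A path in the center of the special unitary group is constant. -/
theorem eq_of_path_central [Nonempty ι] (f : C(I, specialUnitaryGroup ι ℂ))
    (hf : ∀ t g, g * f t = f t * g) (s t : I) : f s = f t := by
  obtain ⟨i⟩ := ‹Nonempty ι›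
  have : Nonempty ι := ⟨i⟩
  have hfin : {z : ℂ | z ^ Fintype.card ι = 1}.Finite := by
    refine (Polynomial.nthRoots (Fintype.card ι) (1 : ℂ)).toFinset.finite_toSet.subset
      fun z hz => ?_
    simpa [Polynomial.mem_nthRoots Fintype.card_pos] using hz
  -- Central elements are scalar, so one diagonal entry determines them; along the path it is
  -- continuous with values in a finite set.
  have hcont : Continuous fun t => (f t : Matrix ι ι ℂ) i i :=
    (continuous_subtype_val.comp f.continuous).matrix_elem i i
  have hpre := isPreconnected_range hcont
  have hsub := hfin.countable.isTotallyDisconnected _ (by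
    rintro _ ⟨t, rfl⟩
    obtain ⟨z, hz, h⟩ := exists_eq_smul_one_of_central (hf t)
    simpa [h] using hz) hpre
  have key := hsub ⟨s, rfl⟩ ⟨t, rfl⟩
  obtain ⟨z, -, hz⟩ := exists_eq_smul_one_of_central (hf s)
  obtain ⟨w, -, hw⟩ := exists_eq_smul_one_of_central (hf t)
  simp only [hz, hw, smul_apply, one_apply_eq, smul_eq_mul, mul_one] at key
  exact Subtype.ext (by rw [hz, hw, key])

/-- A categorical subset of the special unitary group contains at most one central element. -/
theorem eq_of_central_of_isGCategorical [Nonempty ι] {U : Set (specialUnitaryGroup ι ℂ)}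
    (hU : IsGCategorical (ConjAct (specialUnitaryGroup ι ℂ)) U) {x y : specialUnitaryGroup ι ℂ}
    (hx : x ∈ U) (hy : y ∈ U) (hxc : ∀ g, g * x = x * g) (hyc : ∀ g, g * y = y * g) : x = y := by
  obtain ⟨-, hinv, H, hH, hH0, w, hw⟩ := hU
  have key : ∀ x (hx : x ∈ U), (∀ g, g * x = x * g) → x ∈ MulAction.orbit
      (ConjAct (specialUnitaryGroup ι ℂ)) w := by
    intro x hx hxc
    have hfix : ∀ g : ConjAct (specialUnitaryGroup ι ℂ), g • x = x := fun g => by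
      rw [ConjAct.smul_def, hxc, mul_inv_cancel_right]
    -- Equivariance makes the track of a fixed point consist of fixed points, that is, of central
    -- elements.
    have hconst := eq_of_path_central (H.comp ⟨fun t => (⟨x, hx⟩, t), by fun_prop⟩)
      (fun t g => by
        have := hH (ConjAct.toConjAct g) ⟨x, hx⟩ t
        simp only [hfix, ConjAct.toConjAct_smul] at this
        exact mul_inv_eq_iff_eq_mul.1 this) 1 0
    simp only [ContinuousMap.comp_apply, ContinuousMap.coe_mk, hH0] at hconst
    exact hconst ▸ hw ⟨x, hx⟩
  have hxy : x ∈ MulAction.orbit (ConjAct (specialUnitaryGroup ι ℂ)) y := by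
    rw [MulAction.orbit_eq_iff.2 (key y hy hyc)]
    exact key x hx hxc
  obtain ⟨g, hg⟩ := hxy
  rw [← hg]
  show g • y = y
  rw [ConjAct.smul_def, hyc, mul_inv_cancel_right]

theorem card_le_equivariantCat [Nonempty ι] :
    (Fintype.card ι : ℕ∞) ≤
      equivariantCat (ConjAct (specialUnitaryGroup ι ℂ)) (specialUnitaryGroup ι ℂ) := by
  refine le_sInf ?_
  rintro k ⟨C, hC, hcov, rfl⟩
  obtain ⟨ζ, hζ⟩ : ∃ ζ : ℂ, IsPrimitiveRoot ζ (Fintype.card ι) :=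
    ⟨_, Complex.isPrimitiveRoot_exp _ Fintype.card_ne_zero⟩
  have hpow (k : ℕ) : (ζ ^ k) ^ Fintype.card ι = 1 := by rw [pow_right_comm, hζ.1, one_pow]
  have hmem (k : ℕ) : ∃ U ∈ C, scalarSU (ζ ^ k) (hpow k) ∈ U :=
    Set.mem_sUnion.1 (hcov ▸ Set.mem_univ _)
  choose V hVC hV using hmem
  have hinj : Set.InjOn V (Finset.range (Fintype.card ι)) := by
    intro j hj k hk hjk
    have h := eq_of_central_of_isGCategorical (hC _ (hVC j)) (hV j) (hjk ▸ hV k)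
      (fun g => (scalarSU_comm _ g).symm) (fun g => (scalarSU_comm _ g).symm)
    obtain ⟨i⟩ := ‹Nonempty ι›
    have h' := congrFun (congrFun (congrArg Subtype.val h) i) i
    simp only [scalarSU, smul_apply, one_apply_eq, smul_eq_mul, mul_one] at h'
    exact hζ.pow_inj (Finset.mem_range.1 hj) (Finset.mem_range.1 hk) h'
  calc (Fintype.card ι : ℕ∞) = (V '' (Finset.range (Fintype.card ι))).encard := by
        rw [hinj.encard_image, Set.encard_coe_eq_coe_finsetCard, Finset.card_range]
    _ ≤ C.encard := Set.encard_le_encard (by rintro _ ⟨k, -, rfl⟩; exact hVC k)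

end Matrix

/-! ### Logarithm branches for unitaries of a C⋆-algebra. -/

namespace Unitary

variable {A : Type*} [CStarAlgebra A]

open selfAdjoint

/-- The logarithm of a unitary, with arguments taken in `(c - π, c + π)`. -/
noncomputable def logBranch (c : ℝ) (u : unitary A) : selfAdjoint A :=
  argSelfAdjoint (expUnitary (-(c • (1 : selfAdjoint A))) * u) + c • (1 : selfAdjoint A)

theorem expUnitary_add_smul_one (x : selfAdjoint A) (c : ℝ) :
    expUnitary (x + c • (1 : selfAdjoint A)) =
      expUnitary (c • (1 : selfAdjoint A)) * expUnitary x := by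
  rw [add_comm]
  refine Commute.expUnitary_add ?_
  simpa using (Commute.one_left (x : A)).smul_left c

theorem expUnitary_sub_smul_one (x : selfAdjoint A) (c : ℝ) :
    expUnitary (x - c • (1 : selfAdjoint A)) =
      expUnitary (-(c • (1 : selfAdjoint A))) * expUnitary x := by
  rw [sub_eq_add_neg, ← neg_smul, expUnitary_add_smul_one]

theorem expUnitary_smul_one_mul_neg (c : ℝ) :
    expUnitary (c • (1 : selfAdjoint A)) * expUnitary (-(c • (1 : selfAdjoint A))) = 1 := by
  rw [← expUnitary_add_smul_one, neg_add_cancel, expUnitary_zero]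

theorem logBranch_expUnitary {x : selfAdjoint A} {c : ℝ}
    (hx : ‖x - c • (1 : selfAdjoint A)‖ < Real.pi) : logBranch c (expUnitary x) = x := by
  rw [logBranch, ← expUnitary_sub_smul_one, argSelfAdjoint_expUnitary hx, sub_add_cancel]

/-- The domain on which `logBranch c` inverts the exponential. -/
def logDomain (A : Type*) [CStarAlgebra A] (c : ℝ) : Set (unitary A) :=
  (fun u => expUnitary (-(c • (1 : selfAdjoint A))) * u) ⁻¹' Metric.ball 1 2

theorem isOpen_logDomain (c : ℝ) : IsOpen (logDomain A c) :=
  Metric.isOpen_ball.preimage (by fun_prop)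

theorem continuousOn_logBranch (c : ℝ) : ContinuousOn (logBranch (A := A) c) (logDomain A c) :=
  ContinuousOn.add (ContinuousOn.comp (t := Metric.ball 1 2) continuousOn_argSelfAdjoint
    (by fun_prop) fun _ h => h) continuousOn_const

theorem expUnitary_logBranch {c : ℝ} {u : unitary A} (hu : u ∈ logDomain A c) :
    expUnitary (logBranch c u) = u := by
  rw [logBranch, expUnitary_add_smul_one, expUnitary_argSelfAdjoint, ← mul_assoc,
    expUnitary_smul_one_mul_neg, one_mul]
  simpa [logDomain, Subtype.dist_eq, dist_eq_norm] using hu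

theorem norm_logBranch_sub_lt {c : ℝ} {u : unitary A} (hu : u ∈ logDomain A c) :
    ‖logBranch c u - c • (1 : selfAdjoint A)‖ < Real.pi := by
  rw [logBranch, add_sub_cancel_right]
  simpa using (openPartialHomeomorph (A := A)).map_source hu

theorem expUnitary_mem_logDomain {x : selfAdjoint A} {c : ℝ}
    (hx : ‖x - c • (1 : selfAdjoint A)‖ < Real.pi) : expUnitary x ∈ logDomain A c := by
  rw [logDomain, Set.mem_preimage, ← expUnitary_sub_smul_one]
  exact (openPartialHomeomorph (A := A)).map_target (by simpa using hx)

/-- The element `y` commutes with exp(iy) = exp(ix), and `x` is recovered from exp(ix) by the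
continuous functional calculus. -/
theorem commute_of_expUnitary_eq {x y : selfAdjoint A} {c : ℝ}
    (hx : ‖x - c • (1 : selfAdjoint A)‖ < Real.pi) (h : expUnitary x = expUnitary y) :
    Commute (x : A) (y : A) := by
  have h1 : Commute ((expUnitary x : unitary A) : A) (y : A) := by
    rw [h, expUnitary_coe]
    let +nondep : NormedAlgebra ℚ A := .restrictScalars ℚ ℂ A
    exact ((Commute.refl (y : A)).smul_left Complex.I).exp_left
  have h2 : Commute ((expUnitary (-(c • (1 : selfAdjoint A))) : unitary A) : A) (y : A) := by
    rw [expUnitary_coe]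
    let +nondep : NormedAlgebra ℚ A := .restrictScalars ℚ ℂ A
    refine Commute.exp_left (Commute.smul_left ?_ _)
    simpa using (Commute.one_left (y : A)).smul_left c
  have h3 := h2.mul_left h1
  have h4 := h3.star_star
  rw [y.2.star_eq] at h4
  rw [← logBranch_expUnitary hx, logBranch]
  refine Commute.add_left (Commute.cfc h3 h4 _) ?_
  simpa using (Commute.one_left (y : A)).smul_left c

end Unitary

/-! ### Determinant and injectivity of the exponential on Hermitian matrices. -/

namespace Matrix

variable {ι : Type*} [Fintype ι] [DecidableEq ι]

open scoped Matrix.Norms.L2Operator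
open selfAdjoint Unitary

theorem det_expUnitary (X : selfAdjoint (Matrix ι ι ℂ)) :
    (expUnitary X : Matrix ι ι ℂ).det = Complex.exp (Complex.I * (X : Matrix ι ι ℂ).trace) := by
  have hX : (X : Matrix ι ι ℂ).IsHermitian := X.2
  set U : Matrix ι ι ℂ := (hX.eigenvectorUnitary).1
  have hUU : U * star U = 1 := Unitary.coe_mul_star_self hX.eigenvectorUnitary
  have hUi : star U = U⁻¹ := (inv_eq_right_inv hUU).symm
  have hU : IsUnit U := IsUnit.of_mul_eq_one _ hUU
  have hspec : (X : Matrix ι ι ℂ) =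
      U * diagonal (RCLike.ofReal ∘ hX.eigenvalues : ι → ℂ) * U⁻¹ := by
    rw [← hUi]
    exact hX.spectral_theorem
  have htr : (X : Matrix ι ι ℂ).trace = ∑ i, (hX.eigenvalues i : ℂ) := hX.trace_eq_sum_eigenvalues
  rw [expUnitary_coe, htr]
  conv_lhs => rw [hspec]
  rw [← smul_mul_assoc, ← mul_smul_comm, exp_conj _ _ hU, det_conj hU, ← diagonal_smul,
    exp_diagonal, det_diagonal, Finset.mul_sum, Complex.exp_sum]
  simp [Complex.exp_eq_exp_ℂ, Pi.coe_exp]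

theorem exists_int_trace_eq {X : selfAdjoint (Matrix ι ι ℂ)}
    (hX : (expUnitary X : Matrix ι ι ℂ).det = 1) :
    ∃ m : ℤ, (X : Matrix ι ι ℂ).trace = m * (2 * Real.pi) := by
  rw [det_expUnitary, Complex.exp_eq_one_iff] at hX
  obtain ⟨m, hm⟩ := hX
  refine ⟨m, mul_left_cancel₀ Complex.I_ne_zero ?_⟩
  rw [hm]
  ring

/-- X and Y commute, so exp(i(Y - X)) = 1 and the eigenvalues of Y - X lie in 2πℤ. The norm bounds
and c ≤ d make them exceed -2π, hence nonnegative; their sum is 0, so all vanish. -/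
theorem eq_of_expUnitary_eq_of_le {X Y : selfAdjoint (Matrix ι ι ℂ)} {c d : ℝ}
    (hX : ‖X - c • (1 : selfAdjoint (Matrix ι ι ℂ))‖ < Real.pi)
    (hY : ‖Y - d • (1 : selfAdjoint (Matrix ι ι ℂ))‖ < Real.pi)
    (htr : (X : Matrix ι ι ℂ).trace = (Y : Matrix ι ι ℂ).trace)
    (h : expUnitary X = expUnitary Y) (hcd : c ≤ d) : X = Y := by
  have hcomm := commute_of_expUnitary_eq hX h
  have hexp : expUnitary (Y - X) = 1 := by
    have h1 : Commute ((Y - X : selfAdjoint (Matrix ι ι ℂ)) : Matrix ι ι ℂ) (X : Matrix ι ι ℂ) :=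
      hcomm.symm.sub_left (Commute.refl _)
    have h2 := h1.expUnitary_add
    rw [sub_add_cancel, ← h] at h2
    exact right_eq_mul.1 h2
  have hD : ((Y - X : selfAdjoint (Matrix ι ι ℂ)) : Matrix ι ι ℂ).IsHermitian := (Y - X).2
  have hnorm : ‖(Y - X) - (d - c) • (1 : selfAdjoint (Matrix ι ι ℂ))‖ < 2 * Real.pi := by
    have : (Y - X) - (d - c) • (1 : selfAdjoint (Matrix ι ι ℂ)) = (Y - d • 1) - (X - c • 1) := by
      rw [sub_smul]; abel
    rw [this]
    linarith [norm_sub_le (Y - d • (1 : selfAdjoint (Matrix ι ι ℂ))) (X - c • 1)]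
  have hnonneg : ∀ i, 0 ≤ hD.eigenvalues i := by
    intro i
    have hmem := hD.eigenvalues_mem_spectrum_real i
    have hnt : Nonempty ι := ⟨i⟩
    set l := hD.eigenvalues i with hl
    have hlow : -(2 * Real.pi) < l := by
      have h1 : l - (d - c) ∈ spectrum ℝ (((Y - X) - (d - c) • (1 : selfAdjoint (Matrix ι ι ℂ)) :
          selfAdjoint (Matrix ι ι ℂ)) : Matrix ι ι ℂ) := by
        have := Set.sub_mem_sub hmem (Set.mem_singleton (d - c))
        rw [spectrum.sub_singleton_eq, Algebra.algebraMap_eq_smul_one] at this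
        simpa using this
      have h2 := spectrum.norm_le_norm_of_mem h1
      have h3 := abs_lt.1 (lt_of_le_of_lt h2 hnorm)
      linarith [h3.1]
    have hint : ∃ m : ℤ, l = m * (2 * Real.pi) := by
      have h1 : ((l : ℝ) : ℂ) ∈ spectrum ℂ ((Y - X : selfAdjoint (Matrix ι ι ℂ)) : Matrix ι ι ℂ) :=
        (spectrum.algebraMap_mem_iff ℂ).2 hmem
      have h2 : Complex.I * l ∈
          spectrum ℂ (Complex.I • ((Y - X : selfAdjoint (Matrix ι ι ℂ)) : Matrix ι ι ℂ)) :=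
        spectrum.smul_mem_smul_iff (r := Units.mk0 Complex.I Complex.I_ne_zero) |>.2 h1
      have h3 := spectrum.exp_mem_exp _ h2
      rw [← expUnitary_coe, hexp, ← Complex.exp_eq_exp_ℂ] at h3
      have h4 : Complex.exp (Complex.I * l) = 1 := by
        simpa using h3
      obtain ⟨m, hm⟩ := Complex.exp_eq_one_iff.1 h4
      refine ⟨m, ?_⟩
      have h5 : (l : ℂ) = m * (2 * Real.pi) := mul_left_cancel₀ Complex.I_ne_zero (by rw [hm]; ring)
      exact_mod_cast h5
    obtain ⟨m, hm⟩ := hint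
    have hm0 : (-1 : ℝ) < m := by
      rw [hm] at hlow
      nlinarith [Real.pi_pos]
    have hm1 : 0 ≤ m := by
      have : (-1 : ℤ) < m := by exact_mod_cast hm0
      omega
    rw [hm]
    positivity
  have hsum : ∑ i, hD.eigenvalues i = 0 := by
    have h1 := hD.trace_eq_sum_eigenvalues
    have h2 : ((Y - X : selfAdjoint (Matrix ι ι ℂ)) : Matrix ι ι ℂ).trace = 0 := by
      rw [AddSubgroupClass.coe_sub, trace_sub, htr, sub_self]
    rw [h2] at h1
    have h3 : ((∑ i, hD.eigenvalues i : ℝ) : ℂ) = 0 := by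
      rw [Complex.ofReal_sum]
      exact h1.symm
    exact_mod_cast h3
  have hzero := (Finset.sum_eq_zero_iff_of_nonneg fun i _ => hnonneg i).1 hsum
  have := hD.eigenvalues_eq_zero_iff.1 (funext fun i => hzero i (Finset.mem_univ i))
  exact (sub_eq_zero.1 (Subtype.ext this)).symm

theorem eq_of_expUnitary_eq {X Y : selfAdjoint (Matrix ι ι ℂ)} {c d : ℝ}
    (hX : ‖X - c • (1 : selfAdjoint (Matrix ι ι ℂ))‖ < Real.pi)
    (hY : ‖Y - d • (1 : selfAdjoint (Matrix ι ι ℂ))‖ < Real.pi)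
    (htr : (X : Matrix ι ι ℂ).trace = (Y : Matrix ι ι ℂ).trace)
    (h : expUnitary X = expUnitary Y) : X = Y := by
  rcases le_total c d with hcd | hcd
  · exact eq_of_expUnitary_eq_of_le hX hY htr h hcd
  · exact (eq_of_expUnitary_eq_of_le hY hX htr.symm h.symm hcd).symm

end Matrix

/-! ### Central translates of categorical sets. -/

/-- Translation by a central element is an equivariant homeomorphism, so the homotopy can be
transported along it. -/
theorem IsGCategorical.preimage_mul_central {G : Type*} [Group G] [TopologicalSpace G]
    [SeparatelyContinuousMul G] {U : Set G} (hU : IsGCategorical (ConjAct G) U) {z : G}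
    (hz : ∀ g, g * z = z * g) : IsGCategorical (ConjAct G) ((z * ·) ⁻¹' U) := by
  obtain ⟨ho, hinv, H, hH, hH0, y, hy⟩ := hU
  have hz' : ∀ g, g * z⁻¹ = z⁻¹ * g := fun g => (Commute.inv_right (hz g) :)
  have hs : ∀ (g : ConjAct G) (x : G), z * g • x = g • (z * x) := fun g x => by
    rw [ConjAct.smul_def, ConjAct.smul_def, ← mul_assoc, ← mul_assoc, ← mul_assoc, hz]
  have hs' : ∀ (g : ConjAct G) (x : G), z⁻¹ * g • x = g • (z⁻¹ * x) := fun g x => by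
    rw [ConjAct.smul_def, ConjAct.smul_def, ← mul_assoc, ← mul_assoc, ← mul_assoc, hz']
  have hinv' : ∀ (g : ConjAct G) (x : G), x ∈ (z * ·) ⁻¹' U → g • x ∈ (z * ·) ⁻¹' U := by
    intro g x hx
    rw [Set.mem_preimage, hs]
    exact hinv g _ hx
  refine ⟨ho.preimage (continuous_const_mul z), hinv',
    ⟨fun p => z⁻¹ * H (⟨z * (p.1 : G), p.1.2⟩, p.2), ?_⟩, ?_, ?_, z⁻¹ * y, ?_⟩
  · exact (continuous_const_mul z⁻¹).comp (H.continuous.comp (Continuous.prodMk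
      (((continuous_const_mul z).comp (continuous_subtype_val.comp continuous_fst)).subtype_mk _)
      continuous_snd))
  · intro g x t
    simp only [ContinuousMap.coe_mk, ← hs', hH, hs]
  · intro x
    simp [hH0]
  · intro x
    obtain ⟨g, hg⟩ := hy ⟨z * (x : G), x.2⟩
    exact ⟨g, (hs' g y).symm.trans (congrArg (z⁻¹ * ·) hg)⟩

/-! ### The contractible categorical set and its translates. -/

namespace Matrix

variable {ι : Type*} [Fintype ι] [DecidableEq ι]

open scoped Matrix.Norms.L2Operator
open selfAdjoint Unitary Filter Topology

/-- The traceless Hermitian matrices whose spectrum lies in an open interval of length `2π`. -/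
def narrowTraceless (ι : Type*) [Fintype ι] [DecidableEq ι] : Set (selfAdjoint (Matrix ι ι ℂ)) :=
  {X | (X : Matrix ι ι ℂ).trace = 0 ∧
    ∃ c : ℝ, ‖X - c • (1 : selfAdjoint (Matrix ι ι ℂ))‖ < Real.pi}

/-- A special unitary matrix as a unitary matrix. -/
def specialUnitaryGroup.toUnitary (A : specialUnitaryGroup ι ℂ) : unitary (Matrix ι ι ℂ) :=
  ⟨A, A.2.1⟩

open specialUnitaryGroup

theorem continuous_toUnitary : Continuous (toUnitary (ι := ι)) :=
  continuous_subtype_val.subtype_mk _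

/-- The exponential of a traceless Hermitian matrix. -/
noncomputable def expSU (X : selfAdjoint (Matrix ι ι ℂ)) (hX : (X : Matrix ι ι ℂ).trace = 0) :
    specialUnitaryGroup ι ℂ :=
  ⟨expUnitary X, mem_specialUnitaryGroup_iff.2
    ⟨(expUnitary X).2, by rw [det_expUnitary, hX, mul_zero, Complex.exp_zero]⟩⟩

/-- The image of `narrowTraceless` under the exponential. -/
def expNarrow (ι : Type*) [Fintype ι] [DecidableEq ι] : Set (specialUnitaryGroup ι ℂ) :=
  {A | ∃ X ∈ narrowTraceless ι, expUnitary X = toUnitary A}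

open Classical in
/-- The inverse of the exponential on `expNarrow`. -/
noncomputable def logNarrow (A : specialUnitaryGroup ι ℂ) : selfAdjoint (Matrix ι ι ℂ) :=
  if h : A ∈ expNarrow ι then h.choose else 0

theorem logNarrow_mem {A : specialUnitaryGroup ι ℂ} (hA : A ∈ expNarrow ι) :
    logNarrow A ∈ narrowTraceless ι := by
  rw [logNarrow, dif_pos hA]
  exact hA.choose_spec.1

theorem expUnitary_logNarrow {A : specialUnitaryGroup ι ℂ} (hA : A ∈ expNarrow ι) :
    expUnitary (logNarrow A) = toUnitary A := by
  rw [logNarrow, dif_pos hA]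
  exact hA.choose_spec.2

theorem logNarrow_eq {A : specialUnitaryGroup ι ℂ} {X : selfAdjoint (Matrix ι ι ℂ)}
    (hX : X ∈ narrowTraceless ι) (h : expUnitary X = toUnitary A) : logNarrow A = X := by
  have hA : A ∈ expNarrow ι := ⟨X, hX, h⟩
  obtain ⟨h1, c, hc⟩ := logNarrow_mem hA
  obtain ⟨h2, d, hd⟩ := hX
  exact eq_of_expUnitary_eq hc hd (h1.trans h2.symm) ((expUnitary_logNarrow hA).trans h.symm)

/-- The default value 0 is traceless too, so no membership hypothesis is needed. -/
theorem trace_logNarrow (A : specialUnitaryGroup ι ℂ) :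
    (logNarrow A : Matrix ι ι ℂ).trace = 0 := by
  by_cases hA : A ∈ expNarrow ι
  · exact (logNarrow_mem hA).1
  · simp [logNarrow, hA]

theorem trace_smul_logNarrow (A : specialUnitaryGroup ι ℂ) (r : ℝ) :
    ((r • logNarrow A : selfAdjoint (Matrix ι ι ℂ)) : Matrix ι ι ℂ).trace = 0 := by
  rw [selfAdjoint.val_smul, trace_smul, trace_logNarrow, smul_zero]

theorem continuous_trace_selfAdjoint {κ : Type*} [Fintype κ] :
    Continuous fun X : selfAdjoint (Matrix κ κ ℂ) => (X : Matrix κ κ ℂ).trace :=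
  continuous_subtype_val.matrix_trace

/-- At determinant 1 the trace of the logarithm lies in 2πℤ; by continuity it stays near 0, hence
equals 0. -/
theorem eventually_logBranch_mem_narrowTraceless {X : selfAdjoint (Matrix ι ι ℂ)} {c : ℝ}
    (htr : (X : Matrix ι ι ℂ).trace = 0)
    (hc : ‖X - c • (1 : selfAdjoint (Matrix ι ι ℂ))‖ < Real.pi) :
    ContinuousAt (logBranch c) (expUnitary X) ∧ ∀ᶠ u : unitary (Matrix ι ι ℂ) in 𝓝 (expUnitary X),
      (u : Matrix ι ι ℂ).det = 1 → logBranch c u ∈ narrowTraceless ι ∧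
        expUnitary (logBranch c u) = u := by
  have hmem := (isOpen_logDomain c).mem_nhds (expUnitary_mem_logDomain hc)
  have hcont := (continuousOn_logBranch c).continuousAt hmem
  have htrc := continuous_trace_selfAdjoint.continuousAt.comp hcont
  have hsmall : ∀ᶠ u in 𝓝 (expUnitary X), ‖(logBranch c u : Matrix ι ι ℂ).trace‖ < 1 := by
    refine htrc.norm.eventually_lt continuousAt_const ?_
    rw [Function.comp_apply, logBranch_expUnitary hc, htr, norm_zero]
    exact one_pos
  refine ⟨hcont, ?_⟩
  filter_upwards [hmem, hsmall] with u hu hs hdet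
  have hexp := expUnitary_logBranch hu
  refine ⟨⟨?_, c, norm_logBranch_sub_lt hu⟩, hexp⟩
  obtain ⟨m, hm⟩ := exists_int_trace_eq (X := logBranch c u) (by rw [hexp, hdet])
  have hm0 : m = 0 := by
    by_contra h0
    have h1 : (1 : ℝ) ≤ |(m : ℝ)| := by exact_mod_cast Int.one_le_abs h0
    rw [hm, norm_mul, Complex.norm_intCast, norm_mul, Complex.norm_real, Real.norm_eq_abs,
      abs_of_pos Real.pi_pos, Complex.norm_ofNat] at hs
    nlinarith [Real.pi_gt_three]
  rw [hm, hm0, Int.cast_zero, zero_mul]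

theorem exists_continuousAt_log {A : specialUnitaryGroup ι ℂ} (hA : A ∈ expNarrow ι) :
    ∃ f : specialUnitaryGroup ι ℂ → selfAdjoint (Matrix ι ι ℂ), ContinuousAt f A ∧
      ∀ᶠ B in 𝓝 A, f B ∈ narrowTraceless ι ∧ expUnitary (f B) = toUnitary B := by
  obtain ⟨X, ⟨htr, c, hc⟩, hX⟩ := hA
  obtain ⟨h1, h2⟩ := eventually_logBranch_mem_narrowTraceless htr hc
  rw [hX] at h1 h2
  refine ⟨fun B => logBranch c (toUnitary B),
    ContinuousAt.comp (f := toUnitary) h1 continuous_toUnitary.continuousAt, ?_⟩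
  filter_upwards [continuous_toUnitary.continuousAt.eventually h2] with B hB
  exact hB (mem_specialUnitaryGroup_iff.1 B.2).2

theorem isOpen_expNarrow : IsOpen (expNarrow ι) := by
  refine isOpen_iff_mem_nhds.2 fun A hA => ?_
  obtain ⟨f, -, hf⟩ := exists_continuousAt_log hA
  filter_upwards [hf] with B hB using ⟨f B, hB⟩

theorem continuousOn_logNarrow : ContinuousOn (logNarrow (ι := ι)) (expNarrow ι) := by
  intro A hA
  obtain ⟨f, hfc, hf⟩ := exists_continuousAt_log hA
  refine (hfc.congr ?_).continuousWithinAt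
  filter_upwards [hf] with B hB using (logNarrow_eq hB.1 hB.2).symm

/-- Conjugation of a Hermitian matrix by a special unitary one. -/
def conjHermitian (g : specialUnitaryGroup ι ℂ) (X : selfAdjoint (Matrix ι ι ℂ)) :
    selfAdjoint (Matrix ι ι ℂ) :=
  ⟨(g : Matrix ι ι ℂ) * X * star (g : Matrix ι ι ℂ), X.2.conjugate _⟩

theorem expUnitary_conjHermitian (g : specialUnitaryGroup ι ℂ)
    (X : selfAdjoint (Matrix ι ι ℂ)) :
    (expUnitary (conjHermitian g X) : Matrix ι ι ℂ) =
      (g : Matrix ι ι ℂ) * expUnitary X * star (g : Matrix ι ι ℂ) := by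
  have hUU : (g : Matrix ι ι ℂ) * star (g : Matrix ι ι ℂ) = 1 := mem_unitaryGroup_iff.1 g.2.1
  rw [← inv_eq_right_inv hUU, expUnitary_coe, expUnitary_coe,
    ← exp_conj _ _ (IsUnit.of_mul_eq_one _ hUU), inv_eq_right_inv hUU, conjHermitian,
    mul_smul_comm, smul_mul_assoc]

theorem conjHermitian_smul (g : specialUnitaryGroup ι ℂ) (r : ℝ)
    (X : selfAdjoint (Matrix ι ι ℂ)) : conjHermitian g (r • X) = r • conjHermitian g X :=
  Subtype.ext (by simp [conjHermitian])

theorem conjHermitian_mem_narrowTraceless (g : specialUnitaryGroup ι ℂ)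
    {X : selfAdjoint (Matrix ι ι ℂ)} (hX : X ∈ narrowTraceless ι) :
    conjHermitian g X ∈ narrowTraceless ι := by
  obtain ⟨htr, c, hc⟩ := hX
  have hUU : (g : Matrix ι ι ℂ) * star (g : Matrix ι ι ℂ) = 1 := mem_unitaryGroup_iff.1 g.2.1
  refine ⟨?_, c, ?_⟩
  · rw [conjHermitian, trace_mul_comm, ← mul_assoc, mem_unitaryGroup_iff'.1 g.2.1, one_mul, htr]
  · have h : ((conjHermitian g X - c • (1 : selfAdjoint (Matrix ι ι ℂ)) :
        selfAdjoint (Matrix ι ι ℂ)) : Matrix ι ι ℂ) =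
        (g : Matrix ι ι ℂ) * ((X - c • (1 : selfAdjoint (Matrix ι ι ℂ)) :
          selfAdjoint (Matrix ι ι ℂ)) : Matrix ι ι ℂ) * star (g : Matrix ι ι ℂ) := by
      simp [conjHermitian, mul_sub, sub_mul, hUU]
    change ‖((conjHermitian g X - c • (1 : selfAdjoint (Matrix ι ι ℂ)) :
        selfAdjoint (Matrix ι ι ℂ)) : Matrix ι ι ℂ)‖ < Real.pi
    rw [h, CStarRing.norm_mul_mem_unitary _ (Unitary.star_mem g.2.1),
      CStarRing.norm_mem_unitary_mul _ g.2.1]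
    exact hc

theorem coe_conjAct_smul (g : ConjAct (specialUnitaryGroup ι ℂ)) (A : specialUnitaryGroup ι ℂ) :
    ((g • A : specialUnitaryGroup ι ℂ) : Matrix ι ι ℂ) =
      (ConjAct.ofConjAct g).1 * (A : Matrix ι ι ℂ) * star (ConjAct.ofConjAct g).1 :=
  rfl

theorem expUnitary_conjHermitian_eq_toUnitary (g : ConjAct (specialUnitaryGroup ι ℂ))
    {A : specialUnitaryGroup ι ℂ} {X : selfAdjoint (Matrix ι ι ℂ)}
    (h : expUnitary X = toUnitary A) :
    expUnitary (conjHermitian (ConjAct.ofConjAct g) X) = toUnitary (g • A) :=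
  Subtype.ext (by rw [expUnitary_conjHermitian, h, toUnitary, toUnitary, coe_conjAct_smul])

theorem smul_mem_expNarrow (g : ConjAct (specialUnitaryGroup ι ℂ))
    (A : specialUnitaryGroup ι ℂ) (hA : A ∈ expNarrow ι) : g • A ∈ expNarrow ι := by
  obtain ⟨X, hX, h⟩ := hA
  exact ⟨_, conjHermitian_mem_narrowTraceless _ hX, expUnitary_conjHermitian_eq_toUnitary g h⟩

theorem logNarrow_smul (g : ConjAct (specialUnitaryGroup ι ℂ))
    {A : specialUnitaryGroup ι ℂ} (hA : A ∈ expNarrow ι) :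
    logNarrow (g • A) = conjHermitian (ConjAct.ofConjAct g) (logNarrow A) :=
  logNarrow_eq (conjHermitian_mem_narrowTraceless _ (logNarrow_mem hA))
    (expUnitary_conjHermitian_eq_toUnitary g (expUnitary_logNarrow hA))

theorem isGCategorical_expNarrow :
    IsGCategorical (ConjAct (specialUnitaryGroup ι ℂ)) (expNarrow ι) := by
  refine ⟨isOpen_expNarrow, smul_mem_expNarrow,
    ⟨fun p => expSU ((1 - (p.2 : ℝ)) • logNarrow (p.1 : specialUnitaryGroup ι ℂ))
      (trace_smul_logNarrow _ _), ?_⟩, ?_, ?_, 1, ?_⟩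
  · have h1 : Continuous fun A : expNarrow ι => logNarrow (A : specialUnitaryGroup ι ℂ) :=
      continuousOn_iff_continuous_domRestrict.1 continuousOn_logNarrow
    have h2 : Continuous fun p : expNarrow ι × I =>
        (1 - (p.2 : ℝ)) • logNarrow (p.1 : specialUnitaryGroup ι ℂ) :=
      (continuous_const.sub (continuous_subtype_val.comp continuous_snd)).smul
        (h1.comp continuous_fst)
    exact (continuous_subtype_val.comp (continuous_expUnitary.comp h2)).subtype_mk _
  · intro g A t
    refine Subtype.ext ?_
    rw [coe_conjAct_smul]
    simp only [ContinuousMap.coe_mk, expSU, logNarrow_smul g A.2, ← conjHermitian_smul,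
      expUnitary_conjHermitian]
  · intro A
    refine Subtype.ext ?_
    simp only [ContinuousMap.coe_mk, expSU, Set.Icc.coe_zero, sub_zero, one_smul,
      expUnitary_logNarrow A.2]
    rfl
  · intro A
    refine ⟨1, ?_⟩
    refine Subtype.ext ?_
    simp [expSU]

theorem coe_expUnitary_smul_one (r : ℝ) :
    (expUnitary (r • (1 : selfAdjoint (Matrix ι ι ℂ))) : Matrix ι ι ℂ) =
      Complex.exp (Complex.I * r) • (1 : Matrix ι ι ℂ) := by
  have h := NormedSpace.algebraMap_exp_comm (𝕂 := ℂ) (𝔸 := Matrix ι ι ℂ) (Complex.I * r)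
  rw [Algebra.algebraMap_eq_smul_one, Algebra.algebraMap_eq_smul_one, ← Complex.exp_eq_exp_ℂ] at h
  rw [h, expUnitary_coe, mul_smul]
  rfl

/-- The branch at c fails only if -1 is in the spectrum of exp(-ic)u. If all branches failed, the
finite spectrum of -u would contain the whole unit circle. -/
theorem exists_mem_logDomain (u : unitary (Matrix ι ι ℂ)) :
    ∃ c : ℝ, u ∈ logDomain (Matrix ι ι ℂ) c := by
  by_contra! hu
  have hmem : ∀ c : ℝ, Complex.exp (c * Complex.I) ∈ spectrum ℂ (-u : Matrix ι ι ℂ) := by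
    intro c
    have h1 : ¬‖((expUnitary (-(c • (1 : selfAdjoint (Matrix ι ι ℂ)))) * u :
        unitary (Matrix ι ι ℂ)) : Matrix ι ι ℂ) - 1‖ < 2 := fun h =>
      hu c (by simpa [logDomain, Subtype.dist_eq, dist_eq_norm] using h)
    rw [norm_sub_one_lt_two_iff (SetLike.coe_mem _), not_not, ← neg_smul, Submonoid.coe_mul,
      coe_expUnitary_smul_one, smul_mul_assoc, one_mul] at h1
    have h2 := (spectrum.smul_mem_smul_iff (R := ℂ)
      (r := Units.mk0 _ (Complex.exp_ne_zero (c * Complex.I)))).2 h1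
    rw [Units.smul_mk0, Units.smul_mk0, smul_smul, ← Complex.exp_add] at h2
    rw [← spectrum.neg_eq, Set.mem_neg]
    convert! h2 using 1
    · rw [Complex.ofReal_neg, mul_neg, mul_comm Complex.I, add_neg_cancel, Complex.exp_zero,
        one_smul]
    · simp
  have hfin : (Set.Ioc (-Real.pi) Real.pi).Finite := by
    refine Set.Finite.of_injOn (f := fun c : ℝ => Complex.exp (c * Complex.I))
      (fun c _ => hmem c) ?_ (Matrix.finite_spectrum _)
    intro a ha b hb hab
    have := congrArg Complex.arg hab
    have hp : -Real.pi + 2 * Real.pi = Real.pi := by ring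
    rwa [Complex.arg_exp_mul_I, Complex.arg_exp_mul_I,
      (toIocMod_eq_self Real.two_pi_pos).2 (hp.symm ▸ ha),
      (toIocMod_eq_self Real.two_pi_pos).2 (hp.symm ▸ hb)] at this
  exact (Set.Ioc_infinite (by linarith [Real.pi_pos])) hfin

theorem exists_scalar_mul_mem_expNarrow [Nonempty ι] {ζ : ℂ}
    (hζ : ζ = Complex.exp (2 * Real.pi * Complex.I / Fintype.card ι))
    (hpow : ∀ k : ℕ, (ζ ^ k) ^ Fintype.card ι = 1) (A : specialUnitaryGroup ι ℂ) :
    ∃ k < Fintype.card ι, scalarSU (ζ ^ k) (hpow k) * A ∈ expNarrow ι := by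
  obtain ⟨c, hc⟩ := exists_mem_logDomain (toUnitary A)
  set N := Fintype.card ι
  have hN : 0 < N := Fintype.card_pos
  have hNC : (N : ℂ) ≠ 0 := by exact_mod_cast hN.ne'
  have hNZ : (N : ℤ) ≠ 0 := by exact_mod_cast hN.ne'
  set Y := logBranch c (toUnitary A) with hY
  have hexp : expUnitary Y = toUnitary A := expUnitary_logBranch hc
  obtain ⟨m, hm⟩ := exists_int_trace_eq (X := Y) (by
    rw [hexp]
    exact (mem_specialUnitaryGroup_iff.1 A.2).2)
  -- The trace 2πm is spread evenly over the N diagonal entries, so that Y - r • 1 is traceless.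
  set r : ℝ := m * (2 * Real.pi) / N with hr
  have hk0 : 0 ≤ (-m) % (N : ℤ) := Int.emod_nonneg _ hNZ
  have hkN : (-m) % (N : ℤ) < N := Int.emod_lt_of_pos _ (by exact_mod_cast hN)
  have hζ1 : ζ ^ N = 1 := by simpa using hpow 1
  have hζ0 : ζ ≠ 0 := hζ ▸ Complex.exp_ne_zero _
  -- Subtracting r multiplies the exponential by exp(-ir) = ζ ^ (-m); reducing -m modulo N gives an
  -- exponent below N.
  have hζk : ζ ^ ((-m) % (N : ℤ)).toNat = Complex.exp (Complex.I * (-r : ℝ)) := by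
    have h1 : ζ ^ (-m) = ζ ^ ((-m) % (N : ℤ)) := by
      conv_lhs => rw [← Int.mul_ediv_add_emod (-m) N, zpow_add₀ hζ0, _root_.zpow_mul, zpow_natCast, hζ1,
        _root_.one_zpow, one_mul]
    rw [← zpow_natCast, Int.toNat_of_nonneg hk0, ← h1, hζ, ← Complex.exp_int_mul, hr]
    congr 1
    push_cast
    field_simp
  refine ⟨((-m) % (N : ℤ)).toNat, by omega, Y - r • 1, ⟨?_, c - r, ?_⟩, ?_⟩
  · have : ((r • (1 : selfAdjoint (Matrix ι ι ℂ)) : selfAdjoint (Matrix ι ι ℂ)) :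
        Matrix ι ι ℂ).trace = r * N := by
      simp [N]
    rw [AddSubgroupClass.coe_sub, trace_sub, this, hm, hr]
    push_cast
    field_simp
    ring
  · rw [sub_smul, sub_sub_sub_cancel_right]
    exact norm_logBranch_sub_lt hc
  · rw [expUnitary_sub_smul_one, hexp, ← neg_smul]
    refine Subtype.ext ?_
    rw [Submonoid.coe_mul, coe_expUnitary_smul_one, ← hζk]
    rfl

theorem equivariantCat_le_card [Nonempty ι] :
    equivariantCat (ConjAct (specialUnitaryGroup ι ℂ)) (specialUnitaryGroup ι ℂ) ≤
      (Fintype.card ι : ℕ∞) := by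
  have hζ := Complex.isPrimitiveRoot_exp (Fintype.card ι) Fintype.card_ne_zero
  set ζ := Complex.exp (2 * Real.pi * Complex.I / Fintype.card ι) with hdef
  have hpow (k : ℕ) : (ζ ^ k) ^ Fintype.card ι = 1 := by rw [pow_right_comm, hζ.1, one_pow]
  let V : ℕ → Set (specialUnitaryGroup ι ℂ) := fun k =>
    (scalarSU (ζ ^ k) (hpow k) * ·) ⁻¹' expNarrow ι
  refine sInf_le_of_le (b := (V '' Finset.range (Fintype.card ι)).encard) ⟨_, ?_, ?_, rfl⟩ ?_
  · rintro _ ⟨k, -, rfl⟩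
    exact isGCategorical_expNarrow.preimage_mul_central fun g => (scalarSU_comm _ g).symm
  · refine Set.eq_univ_of_forall fun A => ?_
    obtain ⟨k, hk, h⟩ := exists_scalar_mul_mem_expNarrow hdef hpow A
    exact ⟨V k, ⟨k, by simpa using hk, rfl⟩, h⟩
  · refine (Set.encard_image_le _ _).trans ?_
    rw [Set.encard_coe_eq_coe_finsetCard, Finset.card_range]

end Matrix

theorem mainTheorem4 (n : ℕ) :
    equivariantCat (ConjAct (Matrix.specialUnitaryGroup (Fin (n + 1)) ℂ))
      (Matrix.specialUnitaryGroup (Fin (n + 1)) ℂ) = ((n + 1 : ℕ) : ℕ∞) := by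
  have h1 := Matrix.equivariantCat_le_card (ι := Fin (n + 1))
  have h2 := Matrix.card_le_equivariantCat (ι := Fin (n + 1))
  rw [Fintype.card_fin] at h1 h2
  exact le_antisymm h1 h2
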